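/- **Setting.** Let $\mathcal{Y}$ be a finite set of outputs with orthonormal feature vectors $\{\phi(y)\}_{y\in\mathcal{Y}}\subset\mathbb{R}^D$. For $\theta\in\mathbb{R}^D$ let $$\pi_\theta(y)=\frac{\exp\langle\phi(y),\theta\rangle}{\sum_{z\in\mathcal{Y}}\exp\langle\phi(z),\theta\rangle},\qquad \pi_\theta(S)=\sum_{y\in S}\pi_\theta(y)\quad(S\subseteq\mathcal{Y}).$$ For rewards $r_G,r_P:\mathcal{Y}\to[-1,1]$ let $V_G(\theta)=\sum_y\pi_\theta(y)r_G(y)$ and $V_P(\theta)=\sum_y\pi_\theta(y)r_P(y)$. Gradient flow on $V$ from $\theta_0$ is a solution on $[0,\infty)$ of $\frac{d}{dt}\theta_t=\nabla V(\theta_t)$ started at $\theta_0$. **Assumption 1 (rewards).** $\mathcal{Y}=\{y_\star,y_{\mathrm{med}}\}\cup\mathcal{Y}_{\mathrm{bad}}$ with $r_G(y_\star)>r_G(y_{\mathrm{med}})>0\ge\max_{y\in\mathcal{Y}_{\mathrm{bad}}}r_G(y)$, and $r_G$ is constant on $\mathcal{Y}_{\mathrm{bad}}$. For $y_{\mathrm{bad}}\in\mathcal{Y}_{\mathrm{bad}}$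 put $\Delta_1=r_G(y_\star)-r_G(y_{\mathrm{med}})$, $\Delta_2=r_G(y_{\mathrm{med}})-r_G(y_{\mathrm{bad}})$ and $M=\min\{1,\;0.05\,r_G(y_{\mathrm{med}})^{2/7}(\Delta_1+\Delta_2)^{-1}\}$. **Assumption 2 (initial policy).** $$\pi_{\theta_0}(y_\star)<M\cdot\min\Big\{0.01,\Big(\tfrac{21}{1100(\Delta_1+\Delta_2)}\Big)^{7/3},\Delta_2^2\Big\}^{13/14},$$ $$\max\Big\{\tfrac{2\pi_{\theta_0}(y_\star)^{7/13}}{\Delta_2M^{7/13}},\;0.05\,r_G(y_{\mathrm{med}})\Big\}\le\pi_{\theta_0}(\mathcal{Y}_{\mathrm{bad}})\le0.1\,r_G(y_{\mathrm{med}}).$$ Let $r_P$ equal $r_G$ except that $r_P(y_{\mathrm{med}})=\min_{y\in\mathcal{Y}_{\mathrm{bad}}}r_G(y)$. **Theorem.** Under Assumptions 1 and 2, let $\epsilon\in(0,\Delta_1)$. Let $t_\star\in[0,\infty]$ be the first time at which $V_G(\theta_t)\ge r_G(y_\star)-\epsilon$ under gradient flow on $V_G$ from $\theta_0$, and let $t^{\mathrm{no\text{-}med}}_\star$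 be the first time at which $V_G(\theta_t)\ge r_G(y_\star)-\epsilon$ under gradient flow on $V_P$ from $\theta_0$ (a first time is $\infty$ if the level is never reached). - **Case I (maximizing $r_G$).** $$t_\star\ge\frac{2\sqrt2\,M^{14/13}\Delta_1\,r_G(y_{\mathrm{med}})\big(1-e^{-\sqrt2(\Delta_1-\epsilon)}\big)}{(\Delta_1+\Delta_2)(1+8\Delta_1)}\cdot\pi_{\theta_0}(y_\star)^{-14/13}.$$ In particular $t_\star\ge c\,\pi_{\theta_0}(y_\star)^{-14/13}$. - **Case II (maximizing $r_P$).** $$t^{\mathrm{no\text{-}med}}_\star\le B:=\frac{[r_G(y_\star)+1]^2}{\epsilon^2\,[r_P(y_\star)-V_P(\theta_0)]}\cdot\pi_{\theta_0}(y_\star)^{-1}.$$ In particular $t^{\mathrm{no\text{-}med}}_\star\le C\,\pi_{\theta_0}(y_\star)^{-1}$. Furthermore, at every time $t\ge B$ of the gradient flow on $V_P$, $\pi_{\theta_t}(y_\star)\ge1-\epsilon/(\Delta_1+\Delta_2)$. - **Gap.** For every $T\ge0$ there is $\delta_T>0$ such that $\pi_{\theta_0}(y_\star)<\delta_T$ implies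 $t_\star-t^{\mathrm{no\text{-}med}}_\star\ge T$. Here $c,C>0$ depend only on $\epsilon$ and on the reward values $r_G(y_\star)$, $r_G(y_{\mathrm{med}})$, $r_G(y_{\mathrm{bad}})$, and $\delta_T$ depends only on these and on $T$. -/

import Mathlib

open scoped RealInnerProductSpace

noncomputable section

/-- The linear softmax policy `π_θ(y) = exp⟨φ(y), θ⟩ / ∑_z exp⟨φ(z), θ⟩` over a finite set of
outputs `Y`, with feature vectors `φ(y) ∈ ℝ^D`. -/
def softmaxPolicy {Y : Type*} [Fintype Y] {D : ℕ} (φ : Y → EuclideanSpace ℝ (Fin D))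
    (θ : EuclideanSpace ℝ (Fin D)) (y : Y) : ℝ :=
  Real.exp ⟪φ y, θ⟫ / ∑ z, Real.exp ⟪φ z, θ⟫

/-- The expected reward `V(θ) = E_{y ∼ π_θ}[r(y)]`. -/
def expectedReward {Y : Type*} [Fintype Y] {D : ℕ} (φ : Y → EuclideanSpace ℝ (Fin D))
    (r : Y → ℝ) (θ : EuclideanSpace ℝ (Fin D)) : ℝ :=
  ∑ y, softmaxPolicy φ θ y * r y

/-- `θ` is a gradient flow trajectory maximizing `V` from `θ₀`: `θ(0) = θ₀` and
`dθ/dt = ∇V(θ(t))` for all `t ≥ 0` (one-sided derivative at `t = 0`). -/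
structure IsGradientFlow {D : ℕ} (V : EuclideanSpace ℝ (Fin D) → ℝ)
    (θ₀ : EuclideanSpace ℝ (Fin D)) (θ : ℝ → EuclideanSpace ℝ (Fin D)) : Prop where
  init : θ 0 = θ₀
  deriv : ∀ t : ℝ, 0 ≤ t → HasDerivWithinAt θ (gradient V (θ t)) (Set.Ici 0) t

/-- The first time `t ≥ 0` at which `v t ≥ level`; it is `⊤` if there is no such time. -/
def firstTime (v : ℝ → ℝ) (level : ℝ) : EReal :=
  sInf ((fun t : ℝ => (t : EReal)) '' {t : ℝ | 0 ≤ t ∧ level ≤ v t})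

/-- The reward structure: rewards lie in `[-1, 1]`, the outputs are
`{y⋆, y_med} ∪ Y_bad`, `r(y⋆) > r(y_med) > 0 ≥ max_{Y_bad} r`, and `r` is constant on `Y_bad`. -/
structure RewardStructure {Y : Type*} (r : Y → ℝ) (ystar ymed : Y) (Ybad : Finset Y) :
    Prop where
  range : ∀ y, r y ∈ Set.Icc (-1 : ℝ) 1
  decomp : (Set.univ : Set Y) = {ystar, ymed} ∪ (Ybad : Set Y)
  med_lt_star : r ymed < r ystar
  med_pos : 0 < r ymed
  bad_nonpos : ∀ y ∈ Ybad, r y ≤ 0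
  bad_const : ∀ y ∈ Ybad, ∀ y' ∈ Ybad, r y = r y'

/-- `M = min {1, 0.05 · r_med^{2/7} · (Δ₁ + Δ₂)⁻¹}`. -/
def constM (rmed Δ₁ Δ₂ : ℝ) : ℝ :=
  min 1 (0.05 * rmed ^ (2 / 7 : ℝ) * (Δ₁ + Δ₂)⁻¹)

/-- The conditions on the initial policy, for the initial probabilities
`pstar = π_{θ₀}(y⋆)` and `pbad = π_{θ₀}(Y_bad)`. -/
structure InitialPolicyCondition (rmed Δ₁ Δ₂ pstar pbad : ℝ) : Prop where
  star_small : pstar < constM rmed Δ₁ Δ₂ *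
    (min (min 0.01 ((21 / (1100 * (Δ₁ + Δ₂))) ^ (7 / 3 : ℝ))) (Δ₂ ^ 2)) ^ (13 / 14 : ℝ)
  bad_lower : max (2 * pstar ^ (7 / 13 : ℝ) / (Δ₂ * constM rmed Δ₁ Δ₂ ^ (7 / 13 : ℝ)))
    (0.05 * rmed) ≤ pbad
  bad_upper : pbad ≤ 0.1 * rmed

/-- `rP` is identical to `rG`, except that `rP(y_med) = min_{y ∈ Y_bad} rG(y)`. -/
structure IsNoMedProxy {Y : Type*} (rG rP : Y → ℝ) (ymed : Y) (Ybad : Finset Y) : Prop where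
  eq_off : ∀ y, y ≠ ymed → rP y = rG y
  med : IsLeast (rG '' (Ybad : Set Y)) (rP ymed)

/-- The explicit lower bound on the time to reach high reward when maximizing `rG`. -/
def lowerBound (rmed Δ₁ Δ₂ ε pstar : ℝ) : ℝ :=
  2 * √2 * constM rmed Δ₁ Δ₂ ^ (14 / 13 : ℝ) * Δ₁ * rmed *
      (1 - Real.exp (-√2 * (Δ₁ - ε))) / ((Δ₁ + Δ₂) * (1 + 8 * Δ₁)) *
    pstar ^ (-(14 / 13) : ℝ)

/-- The explicit upper bound on the time to reach high reward when maximizing `rP`;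
`VP₀` stands for `V_P(θ₀)`, and `rstar = rG(y⋆) = rP(y⋆)`. -/
def upperBound (rstar VP₀ ε pstar : ℝ) : ℝ :=
  (rstar + 1) ^ 2 / (ε ^ 2 * (rstar - VP₀)) * pstar⁻¹

end

/-! Orthonormality turns the flow into a closed system for the probabilities: `π_y' = π_y (π_y (r_y
- V) - Q)` with `Q = ∑ π_z² (r_z - V)`. An output's own drive carries its probability as a factor,
so an unlikely output is moved mainly by the common term `Q`.

Maximizing `rG`: let `x`, `m`, `b` be the probabilities of the best, the mediocre and the bad
outputs, with gaps `A = Δ₁` and `E = Δ₂`. For small `x`, `Q` is at least about `m b E (m - b) > 0`: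
while the mediocre output displaces the bad ones, the best output loses mass too, and `x ^ 7 / b`
does not increase. Put `u ^ 13 = p / M`, where `p` is the initial `x`. When `b E` has fallen to `u ^
7`, `x` is at most of order `p u`, that is `u ^ 14`, of order `p ^ (14/13)`. From then on `x' ≤ 2 (A
+ E) x ^ 2`, so doubling `x` takes time at least of order `p ^ (-14/13)`.
`ThreeGroupFlow.le_time_of_gap` combines these estimates.

Maximizing `rP`: only two reward levels remain, every output but the best lies below `V`, and `x' ≥
Δ x ^ 2 (1 - x) ^ 2` with `Δ = Δ₁ + Δ₂`. Hence `1 / x` falls at rate at least `η ^ 2 Δ` until `1 - x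
≤ η`, which takes time at most `1 / (η ^ 2 Δ p)` (`IsGradientFlow.le_softmaxPolicy_of_two_level`).

The two bounds differ by a factor of order `p ^ (-1/13)`, which gives the gap. -/

/-! ### Derivatives of the softmax policy and of the value along the flow. -/

section SoftmaxCalculus

variable {Y : Type*} [Fintype Y] {D : ℕ} (φ : Y → EuclideanSpace ℝ (Fin D))

theorem softmaxPolicy_denom_pos [Nonempty Y] (θ : EuclideanSpace ℝ (Fin D)) :
    0 < ∑ z, Real.exp ⟪φ z, θ⟫ :=
  Finset.sum_pos (fun _ _ => Real.exp_pos _) Finset.univ_nonempty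

theorem softmaxPolicy_pos (θ : EuclideanSpace ℝ (Fin D)) (y : Y) : 0 < softmaxPolicy φ θ y :=
  have : Nonempty Y := ⟨y⟩
  div_pos (Real.exp_pos _) (softmaxPolicy_denom_pos φ θ)

theorem sum_softmaxPolicy [Nonempty Y] (θ : EuclideanSpace ℝ (Fin D)) :
    ∑ y, softmaxPolicy φ θ y = 1 := by
  unfold softmaxPolicy
  rw [← Finset.sum_div, div_self (softmaxPolicy_denom_pos φ θ).ne']

theorem hasFDerivAt_softmaxPolicy (θ : EuclideanSpace ℝ (Fin D)) (y : Y) :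
    HasFDerivAt (fun θ => softmaxPolicy φ θ y)
      (softmaxPolicy φ θ y • (innerSL ℝ (φ y) - ∑ z, softmaxPolicy φ θ z • innerSL ℝ (φ z))) θ := by
  have : Nonempty Y := ⟨y⟩
  have he : ∀ z, HasFDerivAt (fun θ : EuclideanSpace ℝ (Fin D) => Real.exp ⟪φ z, θ⟫)
      (Real.exp ⟪φ z, θ⟫ • innerSL ℝ (φ z)) θ := fun z =>
    HasFDerivAt.exp (innerSL ℝ (φ z)).hasFDerivAt
  have hs := HasFDerivAt.fun_sum (u := Finset.univ) fun z _ => he z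
  have hpos := softmaxPolicy_denom_pos φ θ
  refine ((he y).mul ((hasDerivAt_inv hpos.ne').comp_hasFDerivAt θ hs)).congr_fderiv ?_
  ext v
  simp only [softmaxPolicy, add_apply, smul_apply,
    sub_apply, sum_apply, smul_eq_mul,
    innerSL_apply_apply, div_mul_eq_mul_div, Function.comp_apply]
  rw [← Finset.sum_div]
  field_simp
  ring

theorem hasFDerivAt_expectedReward (r : Y → ℝ) (θ : EuclideanSpace ℝ (Fin D)) :
    HasFDerivAt (expectedReward φ r)
      (∑ y, (softmaxPolicy φ θ y * (r y - expectedReward φ r θ)) • innerSL ℝ (φ y)) θ := by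
  have h := HasFDerivAt.fun_sum (u := Finset.univ) fun y _ =>
    (hasFDerivAt_softmaxPolicy φ θ y).mul_const (r y)
  refine h.congr_fderiv ?_
  ext v
  simp only [smul_apply, sub_apply,
    sum_apply, smul_eq_mul, innerSL_apply_apply]
  set S := ∑ z, softmaxPolicy φ θ z * ⟪φ z, v⟫ with hS
  have h1 : ∀ y, r y * (softmaxPolicy φ θ y * (⟪φ y, v⟫ - S))
      = softmaxPolicy φ θ y * r y * ⟪φ y, v⟫ - softmaxPolicy φ θ y * r y * S := fun y => by ring
  have h2 : ∀ y, softmaxPolicy φ θ y * (r y - expectedReward φ r θ) * ⟪φ y, v⟫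
      = softmaxPolicy φ θ y * r y * ⟪φ y, v⟫
        - expectedReward φ r θ * (softmaxPolicy φ θ y * ⟪φ y, v⟫) := fun y => by ring
  simp only [h1, h2, Finset.sum_sub_distrib, ← Finset.sum_mul, ← Finset.mul_sum]
  rfl

/-- Orthonormality enters the proof here: the coordinate of the gradient along `φ z` involves no
cross terms. -/
theorem inner_gradient_expectedReward {φ : Y → EuclideanSpace ℝ (Fin D)} (hφ : Orthonormal ℝ φ)
    (r : Y → ℝ) (θ : EuclideanSpace ℝ (Fin D)) (z : Y) :
    ⟪φ z, gradient (expectedReward φ r) θ⟫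
      = softmaxPolicy φ θ z * (r z - expectedReward φ r θ) := by
  classical
  rw [real_inner_comm, gradient, InnerProductSpace.toDual_symm_apply,
    (hasFDerivAt_expectedReward φ r θ).fderiv]
  simp [orthonormal_iff_ite.1 hφ]

variable {φ} {r : Y → ℝ} {θ₀ : EuclideanSpace ℝ (Fin D)} {θ : ℝ → EuclideanSpace ℝ (Fin D)}

theorem IsGradientFlow.hasDerivWithinAt_softmaxPolicy (hφ : Orthonormal ℝ φ)
    (h : IsGradientFlow (expectedReward φ r) θ₀ θ) (y : Y) {t : ℝ} (ht : 0 ≤ t) :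
    HasDerivWithinAt (fun t => softmaxPolicy φ (θ t) y)
      (softmaxPolicy φ (θ t) y *
        (softmaxPolicy φ (θ t) y * (r y - expectedReward φ r (θ t))
          - ∑ z, softmaxPolicy φ (θ t) z ^ 2 * (r z - expectedReward φ r (θ t))))
      (Set.Ici 0) t := by
  refine ((hasFDerivAt_softmaxPolicy φ (θ t) y).comp_hasDerivWithinAt t (h.deriv t ht)).congr_deriv ?_
  simp only [smul_apply, sub_apply,
    sum_apply, smul_eq_mul, innerSL_apply_apply,
    inner_gradient_expectedReward hφ]
  simp only [pow_two, mul_assoc]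

/-- The derivative of the value is a sum of squares of the gradient's coordinates. -/
theorem IsGradientFlow.monotoneOn_expectedReward (hφ : Orthonormal ℝ φ)
    (h : IsGradientFlow (expectedReward φ r) θ₀ θ) :
    MonotoneOn (fun t => expectedReward φ r (θ t)) (Set.Ici 0) := by
  have hd : ∀ t, 0 ≤ t → HasDerivWithinAt (fun t => expectedReward φ r (θ t))
      (∑ y, (softmaxPolicy φ (θ t) y * (r y - expectedReward φ r (θ t))) ^ 2) (Set.Ici 0) t := by
    intro t ht
    refine ((hasFDerivAt_expectedReward φ r (θ t)).comp_hasDerivWithinAt t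
      (h.deriv t ht)).congr_deriv ?_
    simp only [smul_apply, sum_apply, smul_eq_mul,
      innerSL_apply_apply, inner_gradient_expectedReward hφ, pow_two]
  refine monotoneOn_of_hasDerivWithinAt_nonneg (convex_Ici 0)
    (fun t ht => (hd t ht).continuousWithinAt) (fun t ht => ?_) (fun t _ => ?_)
    (f' := fun t => ∑ y, (softmaxPolicy φ (θ t) y * (r y - expectedReward φ r (θ t))) ^ 2)
  · exact (hd t (interior_subset ht)).mono interior_subset
  · exact Finset.sum_nonneg fun y _ => sq_nonneg _

end SoftmaxCalculus

/-! ### Two-phase analysis of the differential inequalities for `x`, `m`, `b`. -/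

section PhaseAnalysis

open Set

variable {x m b dx db : ℝ → ℝ} {A E rm p u : ℝ}

/-- Differential inequalities for the probabilities `x`, `m`, `b` of the best output, the
mediocre output and the set of bad outputs along a gradient flow; `A` and `E` are the reward gaps. -/
structure ThreeGroupFlow (x m b dx db : ℝ → ℝ) (A E rm : ℝ) : Prop where
  A_pos : 0 < A
  E_pos : 0 < E
  rm_pos : 0 < rm
  x_pos : ∀ t, 0 < x t
  m_pos : ∀ t, 0 < m t
  b_pos : ∀ t, 0 < b t
  sum_eq : ∀ t, x t + m t + b t = 1
  hasDeriv_x : ∀ t, 0 ≤ t → HasDerivWithinAt x (dx t) (Ici 0) t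
  hasDeriv_b : ∀ t, 0 ≤ t → HasDerivWithinAt b (db t) (Ici 0) t
  dx_lt : ∀ t, 0 ≤ t → dx t < x t * (2 * (A + E) * x t - m t * b t * E * (m t - b t))
  neg_db_le : ∀ t, 0 ≤ t → -db t ≤ b t * (b t * E * (m t * (1 + m t)) + x t * (A + E))
  value_lower : ∀ t, 0 ≤ t → 0.7975 * rm ≤ x t + m t * rm

namespace ThreeGroupFlow

theorem continuousOn_x (h : ThreeGroupFlow x m b dx db A E rm) : ContinuousOn x (Ici 0) :=
  fun t ht => (h.hasDeriv_x t ht).continuousWithinAt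

theorem continuousOn_b (h : ThreeGroupFlow x m b dx db A E rm) : ContinuousOn b (Ici 0) :=
  fun t ht => (h.hasDeriv_b t ht).continuousWithinAt

/-- While `b E` dominates `(A + E) x`, the drain `m b E (m - b)` beats the self-growth of `x`. The
second inequality says `7 (log x)' ≤ (log b)'`, the third that `1 / b` grows at rate at most `3 E`.
-/
theorem rates_of_bad_large (h : ThreeGroupFlow x m b dx db A E rm) (hp : p ≤ 0.0025 * rm)
    (hpu : (A + E) * p ≤ 0.05 * u ^ 7) {t : ℝ} (ht : 0 ≤ t) (hx : x t ≤ p)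
    (hb : u ^ 7 ≤ b t * E) :
    dx t < 0 ∧ 7 * dx t * b t ≤ x t * db t ∧ -db t ≤ 3 * E * b t ^ 2 := by
  have hE := h.E_pos
  have hA := h.A_pos
  have hx0 := h.x_pos t
  have hm0 := h.m_pos t
  have hb0 := h.b_pos t
  have hs := h.sum_eq t
  have hd1 := h.dx_lt t ht
  have hd2 := h.neg_db_le t ht
  -- The value is at least `0.7975 * rm` and `x` contributes at most `0.0025 * rm`.
  have hm : 0.795 ≤ m t := by
    have := h.value_lower t ht
    have hrm := h.rm_pos
    by_contra hc
    push Not at hc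
    nlinarith
  have hbE : 0 < b t * E := by positivity
  have hxΔ : (A + E) * x t ≤ 0.05 * (b t * E) := by nlinarith
  have hmb : 0.58 ≤ m t - b t := by linarith
  have hmm : 0.46 ≤ m t * (m t - b t) := by nlinarith
  have e1 : 2 * (A + E) * x t - m t * b t * E * (m t - b t)
      ≤ b t * E * (0.1 - m t * (m t - b t)) := by nlinarith
  have e2 : b t * E * (m t * (1 + m t)) + x t * (A + E)
      ≤ b t * E * (m t * (1 + m t) + 0.05) := by nlinarith
  have hd1' : dx t < x t * (b t * E * (0.1 - m t * (m t - b t))) :=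
    hd1.trans_le (mul_le_mul_of_nonneg_left e1 hx0.le)
  have hd2' : -db t ≤ b t * (b t * E * (m t * (1 + m t) + 0.05)) :=
    hd2.trans (mul_le_mul_of_nonneg_left e2 hb0.le)
  refine ⟨?_, ?_, ?_⟩
  · have : x t * (b t * E * (0.1 - m t * (m t - b t))) ≤ 0 := by
      have : 0.1 - m t * (m t - b t) ≤ 0 := by linarith
      exact mul_nonpos_of_nonneg_of_nonpos hx0.le (mul_nonpos_of_nonneg_of_nonpos hbE.le this)
    linarith
  · have k1 := mul_le_mul_of_nonneg_right hd1'.le hb0.le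
    have k2 := mul_le_mul_of_nonneg_left hd2' hx0.le
    -- Since `m - b > 2 m - 1`, the left side is at most `0.75 + 8 m - 13 m ^ 2`, negative for `m ≥
    -- 0.795`.
    have k3 : 0.7 - 7 * (m t * (m t - b t)) + (m t * (1 + m t) + 0.05) ≤ 0 := by
      nlinarith
    have k4 : x t * b t * (b t * E) *
        (0.7 - 7 * (m t * (m t - b t)) + (m t * (1 + m t) + 0.05)) ≤ 0 :=
      mul_nonpos_of_nonneg_of_nonpos (by positivity) k3
    nlinarith
  · have : m t * (1 + m t) + 0.05 ≤ 3 := by nlinarith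
    have := mul_le_mul_of_nonneg_left this (by positivity : 0 ≤ b t * (b t * E))
    nlinarith

/-- Barrier argument: whenever `x ≤ p`, in particular on contact with the constant `p`, the
derivative of `x` is strictly negative. -/
theorem x_le_of_bad_large (h : ThreeGroupFlow x m b dx db A E rm) (hp : p ≤ 0.0025 * rm)
    (hpu : (A + E) * p ≤ 0.05 * u ^ 7) {T : ℝ} (hx0 : x 0 ≤ p)
    (hb : ∀ s ∈ Ico 0 T, u ^ 7 ≤ b s * E) : ∀ s ∈ Icc 0 T, x s ≤ p := by
  refine image_le_of_deriv_right_lt_deriv_boundary' (f' := dx) (B := fun _ => p)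
    (B' := fun _ => 0) (h.continuousOn_x.mono fun s hs => hs.1) ?_ hx0 continuousOn_const ?_ ?_
  · exact fun s hs => (h.hasDeriv_x s hs.1).mono (Ici_subset_Ici.2 hs.1)
  · exact fun s _ => hasDerivWithinAt_const _ _ _
  · exact fun s hs he => (h.rates_of_bad_large hp hpu hs.1 he.le (hb s hs)).1

theorem pow_div_le_of_bad_large (h : ThreeGroupFlow x m b dx db A E rm) (hp : p ≤ 0.0025 * rm)
    (hpu : (A + E) * p ≤ 0.05 * u ^ 7) {T : ℝ} (hT : 0 ≤ T) (hx0 : x 0 ≤ p)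
    (hb : ∀ s ∈ Ico 0 T, u ^ 7 ≤ b s * E) : x T ^ 7 / b T ≤ x 0 ^ 7 / b 0 := by
  have hx := h.x_le_of_bad_large hp hpu hx0 hb
  have hd : ∀ s, 0 ≤ s → HasDerivWithinAt (fun s => x s ^ 7 / b s)
      ((7 * x s ^ 6 * dx s * b s - x s ^ 7 * db s) / b s ^ 2) (Ici 0) s := fun s hs =>
    ((((h.hasDeriv_x s hs).pow 7).div (h.hasDeriv_b s hs) (h.b_pos s).ne').congr_deriv
      (by simp))
  have hanti : AntitoneOn (fun s => x s ^ 7 / b s) (Icc 0 T) := by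
    refine antitoneOn_of_hasDerivWithinAt_nonpos (convex_Icc 0 T)
      (f' := fun s => (7 * x s ^ 6 * dx s * b s - x s ^ 7 * db s) / b s ^ 2)
      (fun s hs => (hd s hs.1).continuousWithinAt.mono fun r hr => hr.1) ?_ ?_
    · intro s hs
      exact (hd s (interior_subset hs).1).mono fun r hr => (interior_subset hr).1
    · intro s hs
      rw [interior_Icc] at hs
      have h1 := (h.rates_of_bad_large hp hpu hs.1.le (hx s ⟨hs.1.le, hs.2.le⟩)
        (hb s ⟨hs.1.le, hs.2⟩)).2.1
      refine div_nonpos_of_nonpos_of_nonneg ?_ (sq_nonneg _)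
      have := mul_le_mul_of_nonneg_left h1 (pow_pos (h.x_pos s) 6).le
      nlinarith
  exact hanti ⟨le_rfl, hT⟩ ⟨hT, le_rfl⟩ hT

theorem inv_bad_le_of_bad_large (h : ThreeGroupFlow x m b dx db A E rm) (hp : p ≤ 0.0025 * rm)
    (hpu : (A + E) * p ≤ 0.05 * u ^ 7) {T : ℝ} (hT : 0 ≤ T) (hx0 : x 0 ≤ p)
    (hb : ∀ s ∈ Ico 0 T, u ^ 7 ≤ b s * E) : (b T)⁻¹ ≤ (b 0)⁻¹ + 3 * E * T := by
  have hx := h.x_le_of_bad_large hp hpu hx0 hb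
  have hd : ∀ s, 0 ≤ s → HasDerivWithinAt (fun s => (b s)⁻¹ - 3 * E * s)
      (-db s / b s ^ 2 - 3 * E) (Ici 0) s := fun s hs =>
    ((h.hasDeriv_b s hs).inv (h.b_pos s).ne').sub
      (((hasDerivWithinAt_id s _).const_mul (3 * E)).congr_deriv (by simp))
  have hanti : AntitoneOn (fun s => (b s)⁻¹ - 3 * E * s) (Icc 0 T) := by
    refine antitoneOn_of_hasDerivWithinAt_nonpos (convex_Icc 0 T)
      (f' := fun s => -db s / b s ^ 2 - 3 * E)
      (fun s hs => (hd s hs.1).continuousWithinAt.mono fun r hr => hr.1) ?_ ?_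
    · intro s hs
      exact (hd s (interior_subset hs).1).mono fun r hr => (interior_subset hr).1
    · intro s hs
      rw [interior_Icc] at hs
      have h1 := (h.rates_of_bad_large hp hpu hs.1.le (hx s ⟨hs.1.le, hs.2.le⟩)
        (hb s ⟨hs.1.le, hs.2⟩)).2.2
      have := h.b_pos s
      rw [sub_nonpos, div_le_iff₀ (by positivity)]
      exact h1
  have := hanti ⟨le_rfl, hT⟩ ⟨hT, le_rfl⟩ hT
  simp only [mul_zero, sub_zero] at this
  linarith

/-- Comparison with the solution of `z' = 2 (A + E) z ^ 2`, `z(T) = x T`, whose reciprocal decreases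
linearly and is still at least `y⁻¹` at time `t`. -/
theorem x_le_of_time_le (h : ThreeGroupFlow x m b dx db A E rm) {T t y : ℝ} (hT : 0 ≤ T)
    (hTt : T ≤ t) (hy : y ≤ rm / 4) (hy0 : 0 < y)
    (ht : 2 * (A + E) * (t - T) ≤ (x T)⁻¹ - y⁻¹) : x t ≤ y := by
  have hA := h.A_pos
  have hE := h.E_pos
  set K := 2 * (A + E) with hK
  have hKpos : 0 < K := by positivity
  have hle : ∀ s ∈ Icc T t, y⁻¹ ≤ (x T)⁻¹ - K * (s - T) := by
    intro s hs
    have : K * (s - T) ≤ K * (t - T) := by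
      have := hs.2
      gcongr
    linarith
  have hpos : ∀ s ∈ Icc T t, 0 < (x T)⁻¹ - K * (s - T) := fun s hs =>
    (inv_pos.2 hy0).trans_le (hle s hs)
  have hd : ∀ s ∈ Icc T t, HasDerivAt (fun s => ((x T)⁻¹ - K * (s - T))⁻¹)
      (K / ((x T)⁻¹ - K * (s - T)) ^ 2) s := by
    intro s hs
    have h1 : HasDerivAt (fun s => (x T)⁻¹ - K * (s - T)) (-K) s := by
      simpa using (((hasDerivAt_id s).sub_const T).const_mul K).const_sub ((x T)⁻¹)
    exact (h1.inv (hpos s hs).ne').congr_deriv (by simp)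
  have key : ∀ s ∈ Icc T t, x s ≤ ((x T)⁻¹ - K * (s - T))⁻¹ := by
    refine image_le_of_deriv_right_lt_deriv_boundary' (f' := dx)
      (B' := fun s => K / ((x T)⁻¹ - K * (s - T)) ^ 2)
      (h.continuousOn_x.mono fun s hs => hT.trans hs.1) ?_ (by simp)
      (fun s hs => (hd s hs).continuousAt.continuousWithinAt) ?_ ?_
    · exact fun s hs => (h.hasDeriv_x s (hT.trans hs.1)).mono (Ici_subset_Ici.2 (hT.trans hs.1))
    · exact fun s hs => (hd s ⟨hs.1, hs.2.le⟩).hasDerivWithinAt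
    · intro s hs he
      have hs' : s ∈ Icc T t := ⟨hs.1, hs.2.le⟩
      have hs0 := hT.trans hs.1
      have hxy : x s ≤ y := by
        rw [he]
        exact inv_le_of_inv_le₀ hy0 (hle s hs')
      have hx := h.x_pos s
      have hm := h.m_pos s
      have hb := h.b_pos s
      -- With `x ≤ rm / 4` the value bound forces `m > 1/2`; the drain term then has the favourable
      -- sign and can be dropped.
      have hmb : b s ≤ m s := by
        have := h.value_lower s hs0
        have h2 := h.sum_eq s
        have hrm := h.rm_pos
        by_contra hc
        push Not at hc
        nlinarith
      have : K / ((x T)⁻¹ - K * (s - T)) ^ 2 = K * x s ^ 2 := by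
        rw [he, inv_pow, div_eq_mul_inv]
      rw [this]
      have h3 := h.dx_lt s hs0
      have h4 : 0 ≤ x s * (m s * b s * E * (m s - b s)) :=
        mul_nonneg hx.le (mul_nonneg (by positivity) (by linarith))
      nlinarith
  exact (key t ⟨hTt, le_rfl⟩).trans (inv_le_of_inv_le₀ hy0 (hle t ⟨hTt, le_rfl⟩))

/-- The value exceeds `rm` by `x A - b E`. While `b E > u ^ 7`, `x` stays below its initial value,
so `x A < u ^ 7` and this excess is negative; a positive excess requires an earlier crossing. -/
theorem exists_first_bad_small (h : ThreeGroupFlow x m b dx db A E rm) (hu : 0 < u)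
    (hp : x 0 ≤ 0.0025 * rm) (hpu : (A + E) * x 0 ≤ 0.05 * u ^ 7) {t : ℝ} (ht : 0 ≤ t)
    (hgap : b t * E < x t * A) :
    ∃ T ∈ Icc 0 t, b T * E ≤ u ^ 7 ∧ ∀ s ∈ Ico 0 T, u ^ 7 ≤ b s * E := by
  have hE := h.E_pos
  have hex : ∃ s ∈ Icc 0 t, b s * E ≤ u ^ 7 := by
    by_contra hc
    push Not at hc
    have h1 := h.x_le_of_bad_large hp hpu le_rfl
      (fun s hs => (hc s ⟨hs.1, hs.2.le⟩).le) t ⟨ht, le_rfl⟩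
    have h2 := hc t ⟨ht, le_rfl⟩
    have h3 : x t * A ≤ x 0 * A := mul_le_mul_of_nonneg_right h1 h.A_pos.le
    have h4 : 0 < E * x 0 := mul_pos hE (h.x_pos 0)
    have : 0 < u ^ 7 := by positivity
    linarith
  obtain ⟨T, ⟨hTI, hTb⟩, hTmin⟩ : ∃ T, IsLeast {s | s ∈ Icc 0 t ∧ b s * E ≤ u ^ 7} T := by
    refine IsCompact.exists_isLeast ?_ hex
    have hc : ContinuousOn (fun s => b s * E) (Icc 0 t) :=
      (h.continuousOn_b.mono fun s hs => hs.1).mul continuousOn_const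
    exact isCompact_Icc.of_isClosed_subset
      (hc.preimage_isClosed_of_isClosed isClosed_Icc isClosed_Iic) fun s hs => hs.1
  refine ⟨T, hTI, hTb, fun s hs => ?_⟩
  by_contra hc
  push Not at hc
  exact absurd (hTmin ⟨⟨hs.1, hs.2.le.trans hTI.2⟩, hc.le⟩) (not_le.2 hs.2)

/-- Monotonicity of `x ^ 7 / b` gains a factor `u` over the initial `x`, raising `u ^ 13` to `u ^
14`. Of the two factors `rm` in `hp7`, one pays for `b 0 ≥ 0.05 * rm` and the other for `rm ≤ E`. -/
theorem x_small_of_pow_div_le (h : ThreeGroupFlow x m b dx db A E rm) (hrm : rm ≤ 1)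
    (hrmE : rm ≤ E) (hu : 0 < u)
    (hp7 : ((A + E) * x 0) ^ 7 ≤ 0.05 ^ 7 * rm ^ 2 * (u ^ 13) ^ 7) (hb1 : 0.05 * rm ≤ b 0)
    {T : ℝ} (hTb : b T * E ≤ u ^ 7) (hpow : x T ^ 7 / b T ≤ x 0 ^ 7 / b 0) :
    2 * (A + E) * x T * rm ≤ u ^ 14 := by
  have hA := h.A_pos
  have hE := h.E_pos
  have hr0 := h.rm_pos
  have hx00 := h.x_pos 0
  have hxTpos := h.x_pos T
  refine le_of_pow_le_pow_left₀ (n := 7) (by norm_num) (by positivity) ?_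
  rw [div_le_div_iff₀ (h.b_pos T) (h.b_pos 0)] at hpow
  have h1 : x T ^ 7 * (0.05 * rm * E) ≤ x 0 ^ 7 * u ^ 7 := by
    calc x T ^ 7 * (0.05 * rm * E) ≤ x T ^ 7 * (b 0 * E) := by gcongr
      _ = (x T ^ 7 * b 0) * E := by ring
      _ ≤ (x 0 ^ 7 * b T) * E := by gcongr
      _ = x 0 ^ 7 * (b T * E) := by ring
      _ ≤ _ := by gcongr
  have h2 : ((A + E) * x T) ^ 7 * (0.05 * rm * E) ≤ 0.05 ^ 7 * rm ^ 2 * (u ^ 14) ^ 7 := by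
    calc ((A + E) * x T) ^ 7 * (0.05 * rm * E)
        = (A + E) ^ 7 * (x T ^ 7 * (0.05 * rm * E)) := by rw [mul_pow, mul_assoc]
      _ ≤ (A + E) ^ 7 * (x 0 ^ 7 * u ^ 7) := by gcongr
      _ = ((A + E) * x 0) ^ 7 * u ^ 7 := by rw [mul_pow, mul_assoc]
      _ ≤ (0.05 ^ 7 * rm ^ 2 * (u ^ 13) ^ 7) * u ^ 7 := by gcongr
      _ = _ := by ring
  have h3 : ((A + E) * x T) ^ 7 ≤ 0.05 ^ 6 * (u ^ 14) ^ 7 := by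
    refine le_of_mul_le_mul_right (a := 0.05 * rm * E) (h2.trans ?_) (by positivity)
    have : rm ^ 2 ≤ rm * E := by
      rw [pow_two]
      gcongr
    calc (0.05 : ℝ) ^ 7 * rm ^ 2 * (u ^ 14) ^ 7 ≤ 0.05 ^ 7 * (rm * E) * (u ^ 14) ^ 7 := by
          gcongr
      _ = _ := by ring
  calc (2 * (A + E) * x T * rm) ^ 7 = 128 * ((A + E) * x T) ^ 7 * rm ^ 7 := by
        rw [mul_assoc 2, mul_pow, mul_pow]
        norm_num
    _ ≤ 128 * (0.05 ^ 6 * (u ^ 14) ^ 7) * 1 := by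
        gcongr
        exact pow_le_one₀ hr0.le hrm
    _ ≤ (u ^ 14) ^ 7 := by
        have : 0 < (u ^ 14) ^ 7 := by positivity
        linarith

/-- A lower bound on the time at which the value exceeds the reward `rm` by `g`. -/
theorem le_time_of_gap (h : ThreeGroupFlow x m b dx db A E rm) (hrm : rm ≤ 1) (hrmE : rm ≤ E)
    (hu : 0 < u) (hpu : (A + E) * x 0 ≤ 0.05 * u ^ 7)
    (hp7 : ((A + E) * x 0) ^ 7 ≤ 0.05 ^ 7 * rm ^ 2 * (u ^ 13) ^ 7)
    (hub : 2 * u ^ 7 ≤ b 0 * E) (hb1 : 0.05 * rm ≤ b 0) (hp : x 0 ≤ 0.0025 * rm)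
    (hu7 : u ^ 7 ≤ 0.05 * rm * E)
    {g t : ℝ} (hg : 0 < g) (ht : 0 ≤ t) (hgap : g ≤ x t * A - b t * E) :
    4 * A * g * rm / ((A + E) * (1 + 8 * A)) / u ^ 14 ≤ t := by
  have hA := h.A_pos
  have hE := h.E_pos
  have hr0 := h.rm_pos
  obtain ⟨T, hTI, hTb, hbig⟩ := h.exists_first_bad_small hu hp hpu ht (by linarith)
  have hT0 := hTI.1
  have hxT : x T ≤ x 0 := h.x_le_of_bad_large hp hpu le_rfl hbig T ⟨hT0, le_rfl⟩
  have hinv := h.inv_bad_le_of_bad_large hp hpu hT0 le_rfl hbig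
  have hxTpos := h.x_pos T
  have hbT := h.b_pos T
  have hb0 := h.b_pos 0
  have hsmall := h.x_small_of_pow_div_le hrm hrmE hu hp7 hb1 hTb
    (h.pow_div_le_of_bad_large hp hpu hT0 le_rfl hbig)
  have hgA : g ≤ A := by
    have h1 := h.sum_eq t
    have h2 := h.m_pos t
    have h3 := h.b_pos t
    nlinarith [mul_pos h3 hE]
  rw [div_div, div_le_iff₀ (by positivity)]
  rcases le_or_gt (2 * x T) (g / A) with hc | hc
  · -- the probability of the best output has to double after the time `T`
    have hlong : (x T)⁻¹ / 2 ≤ 2 * (A + E) * (t - T) := by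
      by_contra hcon
      push Not at hcon
      have h2 : (2 * x T)⁻¹ = (x T)⁻¹ / 2 := by rw [mul_inv]; ring
      have h1 := h.x_le_of_time_le hT0 hTI.2 (y := 2 * x T) (by linarith) (by positivity)
        (by rw [h2]; linarith)
      have h3 : x t ≤ g / A := h1.trans hc
      rw [le_div_iff₀ hA] at h3
      have := mul_pos (h.b_pos t) hE
      linarith
    have h4 : 1 ≤ 4 * (A + E) * x T * t := by
      have h5 : (x T)⁻¹ ≤ 4 * (A + E) * t := by
        have := mul_nonneg (add_pos hA hE).le hT0
        linarith
      rw [inv_le_iff_one_le_mul₀ hxTpos] at h5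
      linarith
    have h5 : rm ≤ 2 * (t * u ^ 14) := by
      calc rm = rm * 1 := (mul_one _).symm
        _ ≤ rm * (4 * (A + E) * x T * t) := by gcongr
        _ = 2 * (t * (2 * (A + E) * x T * rm)) := by ring
        _ ≤ _ := by gcongr
    calc 4 * A * g * rm ≤ 4 * A * A * rm := by gcongr
      _ ≤ 4 * A * A * (2 * (t * u ^ 14)) := by gcongr
      _ = t * (A * (8 * A) * u ^ 14) := by ring
      _ ≤ t * ((A + E) * (1 + 8 * A) * u ^ 14) := by
          gcongr <;> linarith
  · -- the first phase alone is long enough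
    -- `1 / b` must climb from at most `E / (2 u ^ 7)` to at least `E / u ^ 7` at rate at most `3
    -- E`.
    have hTlong : 1 ≤ 6 * u ^ 7 * T := by
      have hu7pos : 0 < u ^ 7 := by positivity
      have h1 : E / u ^ 7 ≤ (b T)⁻¹ := by
        rw [le_inv_comm₀ (by positivity) hbT, inv_div, le_div_iff₀ hE]
        exact hTb
      have h2 : (b 0)⁻¹ ≤ E / (2 * u ^ 7) := by
        rw [inv_le_comm₀ hb0 (by positivity), inv_div, div_le_iff₀ hE]
        exact hub
      have h3 : E / (2 * u ^ 7) = E / u ^ 7 / 2 := by rw [div_div, mul_comm]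
      have h4 : E / u ^ 7 ≤ 6 * E * T := by linarith
      rw [div_le_iff₀ hu7pos] at h4
      exact le_of_mul_le_mul_left (by linarith) hE
    -- Here `g < 2 A x(T)`, and `x T` is already of order `u ^ 14`, so a time of order `1 / (A + E)`
    -- suffices.
    have ht1 : 1 ≤ (A + E) * t := by
      have h1 : T ≤ t := hTI.2
      have h2 : u ^ 7 * T ≤ 0.05 * rm * E * t := by gcongr
      have h3 : 0.05 * rm * E * t ≤ 0.05 * 1 * E * t := by gcongr
      have h4 := mul_nonneg hA.le ht
      have h5 := mul_nonneg hE.le ht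
      linarith
    rw [div_lt_iff₀ hA] at hc
    calc 4 * A * g * rm ≤ 4 * A * (2 * x T * A) * rm := by gcongr
      _ = 4 * A * A * (2 * x T * rm) * 1 := by ring
      _ ≤ 4 * A * A * (2 * x T * rm) * ((A + E) * t) := by gcongr
      _ = 4 * A * A * t * (2 * (A + E) * x T * rm) := by ring
      _ ≤ 4 * A * A * t * u ^ 14 := by gcongr
      _ = t * (A * (4 * A) * u ^ 14) := by ring
      _ ≤ t * ((A + E) * (1 + 8 * A) * u ^ 14) := by
          gcongr <;> linarith

end ThreeGroupFlow

end PhaseAnalysis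

/-! ### Bounds on first hitting times. -/

section FirstTime

variable {v : ℝ → ℝ} {level L : ℝ}

theorem le_firstTime (h : ∀ t, 0 ≤ t → level ≤ v t → L ≤ t) : (L : EReal) ≤ firstTime v level := by
  refine le_sInf ?_
  rintro _ ⟨t, ht, rfl⟩
  exact EReal.coe_le_coe_iff.2 (h t ht.1 ht.2)

theorem firstTime_le {t : ℝ} (ht : 0 ≤ t) (h : level ≤ v t) : firstTime v level ≤ (t : EReal) :=
  sInf_le ⟨t, ⟨ht, h⟩, rfl⟩

end FirstTime

/-! ### Consequences of the initial-policy assumption. -/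

section InitialPolicy

variable {rm A E p q : ℝ}

theorem constM_pos (hr : 0 < rm) (hA : 0 < A) (hE : 0 < E) : 0 < constM rm A E :=
  lt_min one_pos (by positivity)

/-- The witness is `u = (p / M) ^ (1/13)`, so that the lower bound on `q` reads `2 u ^ 7 ≤ q E`. The
exponent `2/7` of `rm` in `M` becomes the `rm ^ 2` of the seventh-power bound. -/
theorem InitialPolicyCondition.bounds (h : InitialPolicyCondition rm A E p q) (hr : 0 < rm)
    (hr1 : rm ≤ 1) (hA : 0 < A) (hE : 0 < E) (hE2 : E ≤ 2) (hp : 0 < p) :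
    ∃ u : ℝ, 0 < u ∧ u ^ 14 = p ^ (14 / 13 : ℝ) / constM rm A E ^ (14 / 13 : ℝ) ∧
      (A + E) * p ≤ 0.05 * u ^ 7 ∧ ((A + E) * p) ^ 7 ≤ 0.05 ^ 7 * rm ^ 2 * (u ^ 13) ^ 7 ∧
      2 * u ^ 7 ≤ q * E ∧ p ≤ 0.0025 * rm ∧ u ^ 7 ≤ 0.05 * rm * E := by
  have hM := constM_pos hr hA hE
  set M := constM rm A E with hMdef
  have hpM : 0 < p / M := div_pos hp hM
  have hpow : ∀ n : ℕ, ((p / M) ^ (1 / 13 : ℝ)) ^ n = (p / M) ^ (n / 13 : ℝ) := fun n => by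
    rw [← Real.rpow_natCast, ← Real.rpow_mul hpM.le]
    congr 1
    ring
  set u := (p / M) ^ (1 / 13 : ℝ) with hu
  have hu0 : 0 < u := by positivity
  have h7 : u ^ 7 = p ^ (7 / 13 : ℝ) / M ^ (7 / 13 : ℝ) := by
    rw [hpow, Real.div_rpow hp.le hM.le]
    norm_num
  have h13 : u ^ 13 = p / M := by
    rw [hpow]
    norm_num
  have h14 : u ^ 14 = p ^ (14 / 13 : ℝ) / M ^ (14 / 13 : ℝ) := by
    rw [hpow, Real.div_rpow hp.le hM.le]
    norm_num
  have hub : 2 * u ^ 7 ≤ q * E := by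
    have := (le_max_left _ _).trans h.bad_lower
    rw [← hMdef, mul_comm E, ← div_div, div_le_iff₀ hE] at this
    rwa [h7, ← mul_div_assoc]
  have hu7 : u ^ 7 ≤ 0.05 * rm * E := by
    have := mul_le_mul_of_nonneg_right h.bad_upper hE.le
    linarith
  have hu1 : u ≤ 1 := by
    by_contra hc
    push Not at hc
    have h1 : 1 < u ^ 7 := one_lt_pow₀ hc (by norm_num)
    have h2 : rm * E ≤ 1 * 2 := by gcongr
    linarith
  have hMle : (A + E) * M ≤ 0.05 * rm ^ (2 / 7 : ℝ) := by
    have h1 : M ≤ 0.05 * rm ^ (2 / 7 : ℝ) * (A + E)⁻¹ := min_le_right _ _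
    have hAE : 0 < A + E := by positivity
    calc (A + E) * M ≤ (A + E) * (0.05 * rm ^ (2 / 7 : ℝ) * (A + E)⁻¹) := by gcongr
      _ = _ := by field_simp
  have hple : (A + E) * p ≤ 0.05 * rm ^ (2 / 7 : ℝ) * u ^ 13 := by
    have h1 : p = M * u ^ 13 := by rw [h13]; field_simp
    calc (A + E) * p = (A + E) * M * u ^ 13 := by rw [h1]; ring
      _ ≤ _ := by gcongr
  have hrpow : (rm ^ (2 / 7 : ℝ)) ^ 7 = rm ^ 2 := by
    rw [← Real.rpow_natCast, ← Real.rpow_mul hr.le]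
    norm_num
  have hpu : (A + E) * p ≤ 0.05 * u ^ 7 := by
    have h1 : rm ^ (2 / 7 : ℝ) ≤ 1 := Real.rpow_le_one hr.le hr1 (by norm_num)
    have h2 : u ^ 13 ≤ u ^ 7 := pow_le_pow_of_le_one hu0.le hu1 (by norm_num)
    calc (A + E) * p ≤ 0.05 * rm ^ (2 / 7 : ℝ) * u ^ 13 := hple
      _ ≤ 0.05 * 1 * u ^ 7 := by gcongr
      _ = _ := by ring
  refine ⟨u, hu0, h14, hpu, ?_, hub, ?_, hu7⟩
  · calc ((A + E) * p) ^ 7 ≤ (0.05 * rm ^ (2 / 7 : ℝ) * u ^ 13) ^ 7 := by gcongr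
      _ = _ := by rw [mul_pow, mul_pow, hrpow]
  · have h1 : 0 < A * rm := mul_pos hA hr
    have : (A + E) * p ≤ (A + E) * (0.0025 * rm) := by linarith
    exact le_of_mul_le_mul_left this (by positivity)

end InitialPolicy

/-! ### The flow on `rG` satisfies the three-group inequalities. -/

section GroundTruthFlow

/-- `B` stands for the sum of the squared bad probabilities. It enters with a positive coefficient,
so the worst case is `B = b ^ 2`, that of a single bad output. The inequality is strict because the
barrier arguments need strictness on contact. -/
theorem three_group_dx_lt {x m b B A E : ℝ} (hA : 0 < A) (hE : 0 < E) (hx : 0 < x) (hm : 0 < m)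
    (hb : 0 < b) (hs : x + m + b = 1) (hB : B ≤ b ^ 2) :
    x * (x * (m * A + b * (A + E)) - (x ^ 2 * (m * A + b * (A + E)) + m ^ 2 * (b * E - x * A)
      + B * (-(x * (A + E)) - m * E)))
      < x * (2 * (A + E) * x - m * b * E * (m - b)) := by
  refine mul_lt_mul_of_pos_left ?_ hx
  have h1 : B * (x * (A + E) + m * E) ≤ b ^ 2 * (x * (A + E) + m * E) := by gcongr
  have h2 : (m + b) ^ 2 < 1 := by
    have : m + b < 1 := by linarith
    exact pow_lt_one₀ (by positivity) this (by norm_num)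
  have h3 : x * (A * (2 * (m + b) ^ 2) + E * (b * (m + 2 * b))) < x * (2 * (A + E)) := by
    refine mul_lt_mul_of_pos_left ?_ hx
    have e1 : A * (2 * (m + b) ^ 2) < A * 2 := by
      refine mul_lt_mul_of_pos_left ?_ hA
      linarith
    have e2 : E * (b * (m + 2 * b)) < E * 2 := by
      refine mul_lt_mul_of_pos_left ?_ hE
      linarith [mul_pos hm hb, sq_nonneg m]
    linarith
  have h4 : x * (m * A + b * (A + E)) - (x ^ 2 * (m * A + b * (A + E)) + m ^ 2 * (b * E - x * A)
      + b ^ 2 * (-(x * (A + E)) - m * E))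
      = x * (A * (2 * (m + b) ^ 2) + E * (b * (m + 2 * b))) - 2 * (x * A * (m * b))
        - m * b * E * (m - b) := by
    have : x = 1 - m - b := by linarith
    subst this
    ring
  have h5 : 0 < x * A * (m * b) := by positivity
  linarith

theorem three_group_neg_db_le {x m b B A E : ℝ} (hA : 0 < A) (hE : 0 < E) (hx : 0 < x)
    (hm : 0 < m) (hb : 0 < b) (hs : x + m + b = 1) (hB : B ≤ b ^ 2) :
    -(B * (-(x * (A + E)) - m * E) - b * (x ^ 2 * (m * A + b * (A + E))
      + m ^ 2 * (b * E - x * A) + B * (-(x * (A + E)) - m * E)))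
      ≤ b * (b * E * (m * (1 + m)) + x * (A + E)) := by
  have hb1 : 0 < 1 - b := by linarith
  have h1 : (1 - b) * (B * (x * (A + E) + m * E)) ≤ (1 - b) * (b ^ 2 * (x * (A + E) + m * E)) := by
    gcongr
  have h2 : m * A + b * (A + E) ≤ A + E := by
    have : 0 ≤ (1 - m - b) * A + (1 - b) * E := by
      have : 0 ≤ 1 - m - b := by linarith
      positivity
    linarith
  have h3 : b * (x ^ 2 * (m * A + b * (A + E))) ≤ b * (x ^ 2 * (A + E)) := by gcongr
  have h4 : 0 ≤ b * (x * (A + E) * (1 - b - x) + b ^ 2 * x * (A + E) + b ^ 2 * m * E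
      + m ^ 2 * (x * A)) := by
    have : 0 ≤ 1 - b - x := by linarith
    positivity
  linarith

variable {Y : Type*} [Fintype Y] {r : Y → ℝ} {ystar ymed : Y} {Ybad : Finset Y}

theorem RewardStructure.sum_eq (hr : RewardStructure r ystar ymed Ybad) (f : Y → ℝ) :
    ∑ y, f y = f ystar + f ymed + ∑ y ∈ Ybad, f y := by
  classical
  have h1 : ymed ∉ Ybad := fun h => (hr.bad_nonpos _ h).not_gt hr.med_pos
  have h2 : ystar ∉ insert ymed Ybad := by
    rw [Finset.mem_insert, not_or]
    refine ⟨fun h => ?_, fun h => ?_⟩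
    · have := hr.med_lt_star
      rw [h] at this
      exact this.false
    · exact (hr.bad_nonpos _ h).not_gt (hr.med_pos.trans hr.med_lt_star)
  have h3 : (Finset.univ : Finset Y) = insert ystar (insert ymed Ybad) := by
    apply Finset.coe_injective
    rw [Finset.coe_univ, hr.decomp]
    simp [Set.insert_union]
  rw [h3, Finset.sum_insert h2, Finset.sum_insert h1, add_assoc]

variable {D : ℕ} {φ : Y → EuclideanSpace ℝ (Fin D)} {ybad : Y}

theorem RewardStructure.expectedReward_eq (hr : RewardStructure r ystar ymed Ybad)
    (hy : ybad ∈ Ybad) (θ : EuclideanSpace ℝ (Fin D)) :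
    expectedReward φ r θ = softmaxPolicy φ θ ystar * r ystar + softmaxPolicy φ θ ymed * r ymed
      + (∑ y ∈ Ybad, softmaxPolicy φ θ y) * r ybad := by
  rw [expectedReward, hr.sum_eq, Finset.sum_mul]
  congr 1
  exact Finset.sum_congr rfl fun y h => by rw [hr.bad_const y h ybad hy]

theorem RewardStructure.prob_add (hr : RewardStructure r ystar ymed Ybad)
    (θ : EuclideanSpace ℝ (Fin D)) : softmaxPolicy φ θ ystar + softmaxPolicy φ θ ymed
      + ∑ y ∈ Ybad, softmaxPolicy φ θ y = 1 := by
  have : Nonempty Y := ⟨ystar⟩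
  rw [← hr.sum_eq, sum_softmaxPolicy]

theorem RewardStructure.prob_bad_pos (hy : ybad ∈ Ybad)
    (θ : EuclideanSpace ℝ (Fin D)) : 0 < ∑ y ∈ Ybad, softmaxPolicy φ θ y :=
  Finset.sum_pos (fun y _ => softmaxPolicy_pos φ θ y) ⟨ybad, hy⟩

theorem IsGradientFlow.exists_threeGroupFlow {θ₀ : EuclideanSpace ℝ (Fin D)}
    {θ : ℝ → EuclideanSpace ℝ (Fin D)} (hφ : Orthonormal ℝ φ)
    (hr : RewardStructure r ystar ymed Ybad) (hy : ybad ∈ Ybad)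
    (h : IsGradientFlow (expectedReward φ r) θ₀ θ)
    (hp : softmaxPolicy φ θ₀ ystar ≤ 0.0025 * r ymed)
    (hb : ∑ y ∈ Ybad, softmaxPolicy φ θ₀ y ≤ 0.1 * r ymed) :
    ∃ dx db, ThreeGroupFlow (fun t => softmaxPolicy φ (θ t) ystar)
      (fun t => softmaxPolicy φ (θ t) ymed) (fun t => ∑ y ∈ Ybad, softmaxPolicy φ (θ t) y)
      dx db (r ystar - r ymed) (r ymed - r ybad) (r ymed) := by
  set A := r ystar - r ymed with hA
  set E := r ymed - r ybad with hE
  have hA0 : 0 < A := sub_pos.2 hr.med_lt_star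
  have hE0 : 0 < E := sub_pos.2 ((hr.bad_nonpos _ hy).trans_lt hr.med_pos)
  let x : ℝ → ℝ := fun t => softmaxPolicy φ (θ t) ystar
  let m : ℝ → ℝ := fun t => softmaxPolicy φ (θ t) ymed
  let b : ℝ → ℝ := fun t => ∑ y ∈ Ybad, softmaxPolicy φ (θ t) y
  let B : ℝ → ℝ := fun t => ∑ y ∈ Ybad, softmaxPolicy φ (θ t) y ^ 2
  have hx0 : ∀ t, 0 < x t := fun t => softmaxPolicy_pos _ _ _
  have hm0 : ∀ t, 0 < m t := fun t => softmaxPolicy_pos _ _ _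
  have hb0 : ∀ t, 0 < b t := fun t => RewardStructure.prob_bad_pos hy _
  have hs : ∀ t, x t + m t + b t = 1 := fun t => hr.prob_add _
  have hB : ∀ t, B t ≤ b t ^ 2 := fun t =>
    Finset.sum_sq_le_sq_sum_of_nonneg fun y _ => (softmaxPolicy_pos φ (θ t) y).le
  have hV : ∀ t, expectedReward φ r (θ t) = x t * r ystar + m t * r ymed + b t * r ybad :=
    fun t => hr.expectedReward_eq hy _
  have hVs : ∀ t, r ystar - expectedReward φ r (θ t) = m t * A + b t * (A + E) := fun t => by
    rw [hV, hA, hE]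
    linear_combination (-r ystar) * hs t
  have hVm : ∀ t, r ymed - expectedReward φ r (θ t) = b t * E - x t * A := fun t => by
    rw [hV, hA, hE]
    linear_combination (-r ymed) * hs t
  have hVb : ∀ t, r ybad - expectedReward φ r (θ t) = -(x t * (A + E)) - m t * E := fun t => by
    rw [hV, hA, hE]
    linear_combination (-r ybad) * hs t
  have hBsum : ∀ t, ∑ y ∈ Ybad, softmaxPolicy φ (θ t) y ^ 2 * (r y - expectedReward φ r (θ t))
      = B t * (-(x t * (A + E)) - m t * E) := fun t =>
    (Finset.sum_congr rfl fun y h => by rw [hr.bad_const y h ybad hy, hVb]).trans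
      (Finset.sum_mul _ _ _).symm
  have hQ : ∀ t, ∑ z, softmaxPolicy φ (θ t) z ^ 2 * (r z - expectedReward φ r (θ t))
      = x t ^ 2 * (m t * A + b t * (A + E)) + m t ^ 2 * (b t * E - x t * A)
        + B t * (-(x t * (A + E)) - m t * E) := fun t => by
    rw [hr.sum_eq, hVs, hVm, hBsum]
  refine ⟨fun t => x t * (x t * (m t * A + b t * (A + E)) - (x t ^ 2 * (m t * A + b t * (A + E))
      + m t ^ 2 * (b t * E - x t * A) + B t * (-(x t * (A + E)) - m t * E))),
    fun t => B t * (-(x t * (A + E)) - m t * E) - b t * (x t ^ 2 * (m t * A + b t * (A + E))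
      + m t ^ 2 * (b t * E - x t * A) + B t * (-(x t * (A + E)) - m t * E)),
    hA0, hE0, hr.med_pos, hx0, hm0, hb0, hs, ?_, ?_, ?_, ?_, ?_⟩
  · intro t ht
    refine (h.hasDerivWithinAt_softmaxPolicy hφ ystar ht).congr_deriv ?_
    rw [hQ, hVs]
  · intro t ht
    refine (HasDerivWithinAt.fun_sum fun y (_ : y ∈ Ybad) =>
      h.hasDerivWithinAt_softmaxPolicy hφ y ht).congr_deriv ?_
    have key : ∀ Q, ∑ y ∈ Ybad, softmaxPolicy φ (θ t) y *
        (softmaxPolicy φ (θ t) y * (r y - expectedReward φ r (θ t)) - Q)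
        = B t * (-(x t * (A + E)) - m t * E) - b t * Q := fun Q => by
      rw [← hBsum, Finset.sum_mul, ← Finset.sum_sub_distrib]
      exact Finset.sum_congr rfl fun y _ => by ring
    rw [hQ]
    exact key _
  · exact fun t _ => three_group_dx_lt hA0 hE0 (hx0 t) (hm0 t) (hb0 t) (hs t) (hB t)
  · exact fun t _ => three_group_neg_db_le hA0 hE0 (hx0 t) (hm0 t) (hb0 t) (hs t) (hB t)
  · intro t ht
    have h1 : expectedReward φ r (θ 0) ≤ expectedReward φ r (θ t) :=
      h.monotoneOn_expectedReward hφ Set.self_mem_Ici ht ht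
    rw [hV, hV] at h1
    rw [← h.init] at hp hb
    change x 0 ≤ _ at hp
    change b 0 ≤ _ at hb
    have hrm := hr.med_pos
    have hrm1 := (hr.range ymed).2
    have h2 : b t * r ybad ≤ 0 := mul_nonpos_of_nonneg_of_nonpos (hb0 t).le (hr.bad_nonpos _ hy)
    have h3 : x t * r ystar ≤ x t * 1 := mul_le_mul_of_nonneg_left (hr.range _).2 (hx0 t).le
    have h4 : b 0 * (-1) ≤ b 0 * r ybad := mul_le_mul_of_nonneg_left (hr.range _).1 (hb0 0).le
    have h5 : 0 ≤ x 0 * r ystar := (mul_pos (hx0 0) (hrm.trans hr.med_lt_star)).le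
    -- Initially `x + b ≤ 0.1025 * r ymed ≤ 0.1025`. Subtracting the loss `b ≤ 0.1 * r ymed` leaves
    -- `0.7975`.
    have h6 : 0.8975 * r ymed ≤ m 0 * r ymed := by
      have := hs 0
      gcongr
      linarith
    change 0.7975 * r ymed ≤ x t + m t * r ymed
    linarith

end GroundTruthFlow

/-! ### The flow for a reward with two levels. -/

section TwoLevelFlow

variable {Y : Type*} [Fintype Y] {D : ℕ} {φ : Y → EuclideanSpace ℝ (Fin D)} {r : Y → ℝ}
  {ystar : Y} {rlow : ℝ}

theorem expectedReward_eq_of_two_level (hr : ∀ y, y ≠ ystar → r y = rlow)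
    (θ : EuclideanSpace ℝ (Fin D)) :
    expectedReward φ r θ = rlow + softmaxPolicy φ θ ystar * (r ystar - rlow) := by
  classical
  have : Nonempty Y := ⟨ystar⟩
  have h1 : expectedReward φ r θ - rlow
      = ∑ y, softmaxPolicy φ θ y * (r y - rlow) := by
    simp only [mul_sub, Finset.sum_sub_distrib, ← Finset.sum_mul, sum_softmaxPolicy, one_mul]
    rfl
  rw [Finset.sum_eq_single ystar (fun y _ hy => by rw [hr y hy, sub_self, mul_zero])
    (fun h => absurd (Finset.mem_univ _) h)] at h1
  linarith

theorem softmaxPolicy_le_one (θ : EuclideanSpace ℝ (Fin D)) (y : Y) : softmaxPolicy φ θ y ≤ 1 := by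
  have : Nonempty Y := ⟨y⟩
  rw [← sum_softmaxPolicy φ θ]
  exact Finset.single_le_sum (f := softmaxPolicy φ θ) (fun z _ => (softmaxPolicy_pos φ θ z).le)
    (Finset.mem_univ y)

/-- If `1 - x` still exceeded `η` at time `t`, then by monotonicity it did so throughout, and `1 /
x` would have dropped to zero or below. -/
theorem IsGradientFlow.le_softmaxPolicy_of_two_level {θ₀ : EuclideanSpace ℝ (Fin D)}
    {θ : ℝ → EuclideanSpace ℝ (Fin D)} (hφ : Orthonormal ℝ φ)
    (h : IsGradientFlow (expectedReward φ r) θ₀ θ) (hr : ∀ y, y ≠ ystar → r y = rlow)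
    (hlow : rlow < r ystar) {η t : ℝ} (hη : 0 < η) (ht0 : 0 ≤ t)
    (ht : (softmaxPolicy φ θ₀ ystar)⁻¹ ≤ η ^ 2 * (r ystar - rlow) * t) :
    1 - η ≤ softmaxPolicy φ (θ t) ystar := by
  classical
  set Δ := r ystar - rlow with hΔ
  have hΔ0 : 0 < Δ := sub_pos.2 hlow
  set x : ℝ → ℝ := fun t => softmaxPolicy φ (θ t) ystar with hx
  have hx0 : ∀ t, 0 < x t := fun t => softmaxPolicy_pos _ _ _
  have hx1 : ∀ t, x t ≤ 1 := fun t => softmaxPolicy_le_one _ _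
  have hV : ∀ t, expectedReward φ r (θ t) = rlow + x t * Δ := fun t =>
    expectedReward_eq_of_two_level hr _
  let dx : ℝ → ℝ := fun t => x t * (x t * (r ystar - expectedReward φ r (θ t))
    - ∑ z, softmaxPolicy φ (θ t) z ^ 2 * (r z - expectedReward φ r (θ t)))
  have hd : ∀ t, 0 ≤ t → HasDerivWithinAt x (dx t) (Set.Ici 0) t := fun t ht =>
    h.hasDerivWithinAt_softmaxPolicy hφ ystar ht
  have hdx : ∀ t, x t ^ 2 * ((1 - x t) ^ 2 * Δ) ≤ dx t := by
    intro t
    -- Every output other than `ystar` has reward below the value, so its term is nonpositive.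
    have h1 : ∑ z, softmaxPolicy φ (θ t) z ^ 2 * (r z - expectedReward φ r (θ t))
        ≤ x t ^ 2 * (r ystar - expectedReward φ r (θ t)) := by
      rw [← Finset.add_sum_erase _ _ (Finset.mem_univ ystar)]
      refine add_le_of_nonpos_right (Finset.sum_nonpos fun z hz => ?_)
      rw [hr z (Finset.ne_of_mem_erase hz), hV]
      have := mul_pos (hx0 t) hΔ0
      exact mul_nonpos_of_nonneg_of_nonpos (sq_nonneg _) (by linarith)
    have h2 : r ystar - expectedReward φ r (θ t) = (1 - x t) * Δ := by
      rw [hV, hΔ]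
      ring
    calc x t ^ 2 * ((1 - x t) ^ 2 * Δ)
        = x t * (x t * (r ystar - expectedReward φ r (θ t))
          - x t ^ 2 * (r ystar - expectedReward φ r (θ t))) := by rw [h2]; ring
      _ ≤ dx t := mul_le_mul_of_nonneg_left (by linarith) (hx0 t).le
  have hmono : MonotoneOn x (Set.Ici 0) := by
    refine monotoneOn_of_hasDerivWithinAt_nonneg (convex_Ici 0)
      (fun t ht => (hd t ht).continuousWithinAt)
      (fun t ht => (hd t (interior_subset ht)).mono interior_subset) fun t _ => ?_
    exact (by positivity : 0 ≤ x t ^ 2 * ((1 - x t) ^ 2 * Δ)).trans (hdx t)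
  by_contra hc
  push Not at hc
  have hlt : ∀ s ∈ Set.Icc 0 t, η ≤ 1 - x s := by
    intro s hs
    have : x s ≤ x t := hmono hs.1 ht0 hs.2
    linarith
  have hd2 : ∀ s, 0 ≤ s → HasDerivWithinAt (fun s => (x s)⁻¹ + η ^ 2 * Δ * s)
      (-dx s / x s ^ 2 + η ^ 2 * Δ) (Set.Ici 0) s := fun s hs =>
    ((hd s hs).inv (hx0 s).ne').add
      (((hasDerivWithinAt_id s _).const_mul (η ^ 2 * Δ)).congr_deriv (by simp))
  have hanti : AntitoneOn (fun s => (x s)⁻¹ + η ^ 2 * Δ * s) (Set.Icc 0 t) := by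
    refine antitoneOn_of_hasDerivWithinAt_nonpos (convex_Icc 0 t)
      (f' := fun s => -dx s / x s ^ 2 + η ^ 2 * Δ)
      (fun s hs => (hd2 s hs.1).continuousWithinAt.mono fun r hr => hr.1) ?_ ?_
    · intro s hs
      exact (hd2 s (interior_subset hs).1).mono fun r hr => (interior_subset hr).1
    · intro s hs
      have h1 := hlt s (interior_subset hs)
      have h2 : x s ^ 2 * (η ^ 2 * Δ) ≤ dx s := by
        refine le_trans ?_ (hdx s)
        gcongr
      have h3 : η ^ 2 * Δ ≤ dx s / x s ^ 2 := by
        rw [le_div_iff₀ (pow_pos (hx0 s) 2)]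
        linarith
      rw [neg_div]
      linarith
  have h1 := hanti ⟨le_rfl, ht0⟩ ⟨ht0, le_rfl⟩ ht0
  have h2 : x 0 = softmaxPolicy φ θ₀ ystar := by rw [hx, ← h.init]
  simp only [mul_zero, add_zero, h2] at h1
  have := inv_pos.2 (hx0 t)
  linarith

end TwoLevelFlow

/-! ### The proxy reward has two levels. -/

section NoMedProxy

variable {Y : Type*} {rG rP : Y → ℝ} {ystar ymed ybad : Y} {Ybad : Finset Y}

theorem IsNoMedProxy.apply_star (hP : IsNoMedProxy rG rP ymed Ybad)
    (hr : RewardStructure rG ystar ymed Ybad) : rP ystar = rG ystar :=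
  hP.eq_off _ fun h => (h ▸ hr.med_lt_star).false

theorem IsNoMedProxy.eq_of_ne (hP : IsNoMedProxy rG rP ymed Ybad)
    (hr : RewardStructure rG ystar ymed Ybad) (hy : ybad ∈ Ybad) :
    ∀ y, y ≠ ystar → rP y = rG ybad := by
  intro y hne
  by_cases hm : y = ymed
  · obtain ⟨z, hz, hzeq⟩ := hP.med.1
    rw [hm, ← hzeq, hr.bad_const z hz ybad hy]
  · rw [hP.eq_off y hm]
    have hmem : y ∈ ({ystar, ymed} ∪ (Ybad : Set Y) : Set Y) := hr.decomp ▸ Set.mem_univ y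
    rcases hmem with (h | h) | h
    · exact absurd h hne
    · exact absurd h hm
    · exact hr.bad_const y h ybad hy

end NoMedProxy

/-! ### Explicit time bounds and their comparison. -/

section HittingTimes

theorem lowerBound_eq_mul_rpow (rm A E ε p : ℝ) :
    lowerBound rm A E ε p = lowerBound rm A E ε 1 * p ^ (-(14 / 13) : ℝ) := by
  simp [lowerBound]

theorem lowerBound_pos {rm A E ε p : ℝ} (hr : 0 < rm) (hA : 0 < A) (hE : 0 < E) (hε : ε < A)
    (hp : 0 < p) : 0 < lowerBound rm A E ε p := by
  have hM := constM_pos hr hA hE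
  have h1 : 0 < 1 - Real.exp (-√2 * (A - ε)) := by
    rw [sub_pos, Real.exp_lt_one_iff, neg_mul, neg_lt_zero]
    have : 0 < A - ε := sub_pos.2 hε
    positivity
  unfold lowerBound
  positivity

/-- The bound `1 - exp (-s) ≤ s` at `s = √2 (A - ε)` turns the exponential factor into the gap `A -
ε`, and `√2 * √2 = 2` yields the constant `4`. -/
theorem lowerBound_le {rm A E ε p u : ℝ} (hr : 0 < rm) (hA : 0 < A) (hE : 0 < E)
    (hp : 0 < p) (hu : 0 < u)
    (hu14 : u ^ 14 = p ^ (14 / 13 : ℝ) / constM rm A E ^ (14 / 13 : ℝ)) :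
    lowerBound rm A E ε p ≤ 4 * A * (A - ε) * rm / ((A + E) * (1 + 8 * A)) / u ^ 14 := by
  have hM := constM_pos hr hA hE
  have h1 : 1 - Real.exp (-√2 * (A - ε)) ≤ √2 * (A - ε) := by
    have := Real.add_one_le_exp (-√2 * (A - ε))
    linarith
  have h2 : constM rm A E ^ (14 / 13 : ℝ) * p ^ (-(14 / 13) : ℝ) = (u ^ 14)⁻¹ := by
    rw [hu14, inv_div, Real.rpow_neg hp.le]
    rfl
  have h3 : √2 * √2 = 2 := Real.mul_self_sqrt (by norm_num)
  calc lowerBound rm A E ε p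
      = 2 * √2 * A * rm * (1 - Real.exp (-√2 * (A - ε))) / ((A + E) * (1 + 8 * A))
        * (constM rm A E ^ (14 / 13 : ℝ) * p ^ (-(14 / 13) : ℝ)) := by
        unfold lowerBound
        ring
    _ ≤ 2 * √2 * A * rm * (√2 * (A - ε)) / ((A + E) * (1 + 8 * A)) * (u ^ 14)⁻¹ := by
        rw [h2]
        gcongr
    _ = 2 * (√2 * √2) * A * (A - ε) * rm / ((A + E) * (1 + 8 * A)) / u ^ 14 := by
        rw [← div_eq_mul_inv]
        ring
    _ = _ := by
        rw [h3]
        ring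

/-- With `w = p ^ (1/13)` the right side is `p⁻¹ (c / w - C)`. The threshold makes `c / w ≥ C + T`
and `p⁻¹ ≥ 1`. -/
theorem le_mul_rpow_sub_mul_inv {c C T p : ℝ} (hc : 0 < c) (hC : 0 < C) (hT : 0 ≤ T) (hp : 0 < p)
    (hlt : p < min 1 ((c / (C + T)) ^ 13)) :
    T ≤ c * p ^ (-(14 / 13) : ℝ) - C * p⁻¹ := by
  obtain ⟨h1, h2⟩ := lt_min_iff.1 hlt
  have hCT : 0 < C + T := by positivity
  set w := p ^ (1 / 13 : ℝ) with hw
  have hw0 : 0 < w := by positivity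
  have hw13 : w ^ 13 = p := by
    rw [hw, ← Real.rpow_natCast, ← Real.rpow_mul hp.le]
    norm_num
  have h3 : w < c / (C + T) := by
    rw [← hw13] at h2
    exact lt_of_pow_lt_pow_left₀ 13 (by positivity) h2
  have h4 : p ^ (-(14 / 13) : ℝ) = p⁻¹ * w⁻¹ := by
    rw [hw, ← Real.rpow_neg hp.le, ← Real.rpow_neg_one, ← Real.rpow_add hp]
    norm_num
  have h5 : C + T ≤ c * w⁻¹ := by
    rw [lt_div_iff₀ hCT] at h3
    rw [← div_eq_mul_inv, le_div_iff₀ hw0]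
    linarith
  have h6 : 1 ≤ p⁻¹ := (one_le_inv₀ hp).2 h1.le
  calc T ≤ p⁻¹ * T := le_mul_of_one_le_left hT h6
    _ ≤ p⁻¹ * (c * w⁻¹ - C) := by
        gcongr
        linarith
    _ = _ := by
        rw [h4]
        ring

variable {Y : Type*} [Fintype Y] {D : ℕ} {φ : Y → EuclideanSpace ℝ (Fin D)} {rG rP : Y → ℝ}
  {ystar ymed ybad : Y} {Ybad : Finset Y} {θ₀ : EuclideanSpace ℝ (Fin D)}
  {θ : ℝ → EuclideanSpace ℝ (Fin D)} {ε : ℝ}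

theorem IsGradientFlow.lowerBound_le_firstTime (hφ : Orthonormal ℝ φ)
    (hr : RewardStructure rG ystar ymed Ybad) (hy : ybad ∈ Ybad)
    (hi : InitialPolicyCondition (rG ymed) (rG ystar - rG ymed) (rG ymed - rG ybad)
      (softmaxPolicy φ θ₀ ystar) (∑ y ∈ Ybad, softmaxPolicy φ θ₀ y))
    (hε : ε < rG ystar - rG ymed) (h : IsGradientFlow (expectedReward φ rG) θ₀ θ) :
    ((lowerBound (rG ymed) (rG ystar - rG ymed) (rG ymed - rG ybad) ε
      (softmaxPolicy φ θ₀ ystar) : ℝ) : EReal)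
      ≤ firstTime (fun t => expectedReward φ rG (θ t)) (rG ystar - ε) := by
  have hrm := hr.med_pos
  have hrm1 := (hr.range ymed).2
  have hbad := hr.bad_nonpos _ hy
  have hA : 0 < rG ystar - rG ymed := sub_pos.2 hr.med_lt_star
  have hE : 0 < rG ymed - rG ybad := by linarith
  have hE2 : rG ymed - rG ybad ≤ 2 := by linarith [(hr.range ybad).1]
  have hp := softmaxPolicy_pos φ θ₀ ystar
  obtain ⟨u, hu, hu14, hpu, hp7, hub, hp1, hu7⟩ := hi.bounds hrm hrm1 hA hE hE2 hp
  obtain ⟨dx, db, hf⟩ := h.exists_threeGroupFlow hφ hr hy hp1 hi.bad_upper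
  refine le_firstTime fun t ht hlev => (lowerBound_le hrm hA hE hp hu hu14).trans ?_
  have hlow := (le_max_right _ _).trans hi.bad_lower
  rw [← h.init] at hpu hp7 hub hp1 hlow
  refine hf.le_time_of_gap hrm1 (by linarith) hu hpu hp7 hub hlow hp1 hu7 (sub_pos.2 hε) ht ?_
  rw [hr.expectedReward_eq hy] at hlev
  linear_combination hlev + rG ymed * hr.prob_add (φ := φ) (θ t)

theorem RewardStructure.sub_le_expectedReward (hr : RewardStructure rG ystar ymed Ybad)
    (hy : ybad ∈ Ybad) {ϑ : EuclideanSpace ℝ (Fin D)}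
    (h : 1 - ε / (rG ystar - rG ybad) ≤ softmaxPolicy φ ϑ ystar) :
    rG ystar - ε ≤ expectedReward φ rG ϑ := by
  have hbad := hr.bad_nonpos _ hy
  have hE : 0 < rG ymed - rG ybad := by linarith [hr.med_pos]
  have hΔ : 0 < rG ystar - rG ybad := by linarith [hr.med_lt_star]
  have h1 : (1 - softmaxPolicy φ ϑ ystar) * (rG ystar - rG ybad) ≤ ε := by
    rw [← le_div_iff₀ hΔ]
    linarith
  have h2 := mul_pos (softmaxPolicy_pos φ ϑ ymed) hE
  rw [hr.expectedReward_eq hy]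
  have h3 := hr.prob_add (φ := φ) ϑ
  have h4 : ∑ y ∈ Ybad, softmaxPolicy φ ϑ y
      = 1 - softmaxPolicy φ ϑ ystar - softmaxPolicy φ ϑ ymed := by linarith
  rw [h4]
  linarith

/-- The time bound for the proxy reward is positive, at most of order `1 / p`, and beyond it the
best output has probability at least `1 - ε / Δ`. -/
theorem IsGradientFlow.upperBound_spec (hφ : Orthonormal ℝ φ)
    (hr : RewardStructure rG ystar ymed Ybad) (hy : ybad ∈ Ybad)
    (hP : IsNoMedProxy rG rP ymed Ybad) (hε : 0 < ε) (hp : softmaxPolicy φ θ₀ ystar ≤ 1 / 2)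
    (h : IsGradientFlow (expectedReward φ rP) θ₀ θ) :
    0 < upperBound (rP ystar) (expectedReward φ rP θ₀) ε (softmaxPolicy φ θ₀ ystar) ∧
    upperBound (rP ystar) (expectedReward φ rP θ₀) ε (softmaxPolicy φ θ₀ ystar)
      ≤ (rG ystar + 1) ^ 2 / (ε ^ 2 * ((rG ystar - rG ybad) / 2))
        * (softmaxPolicy φ θ₀ ystar)⁻¹ ∧
    ∀ t, upperBound (rP ystar) (expectedReward φ rP θ₀) ε (softmaxPolicy φ θ₀ ystar) ≤ t →
      1 - ε / (rG ystar - rG ybad) ≤ softmaxPolicy φ (θ t) ystar := by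
  have hlow := hP.eq_of_ne hr hy
  have hbad := hr.bad_nonpos _ hy
  have hstar : 0 < rG ystar := hr.med_pos.trans hr.med_lt_star
  have hΔ : 0 < rG ystar - rG ybad := by linarith
  have hp0 := softmaxPolicy_pos φ θ₀ ystar
  have hgap : rP ystar - expectedReward φ rP θ₀
      = (1 - softmaxPolicy φ θ₀ ystar) * (rG ystar - rG ybad) := by
    rw [expectedReward_eq_of_two_level hlow, hP.apply_star hr]
    ring
  set p := softmaxPolicy φ θ₀ ystar with hpdef
  set Δ := rG ystar - rG ybad with hΔdef
  have hgap1 : Δ / 2 ≤ (1 - p) * Δ := by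
    have := mul_le_mul_of_nonneg_right hp hΔ.le
    linarith
  have hgap2 : (1 - p) * Δ ≤ Δ := by
    have := mul_pos hp0 hΔ
    linarith
  have hgap0 : 0 < (1 - p) * Δ := (by positivity : 0 < Δ / 2).trans_le hgap1
  have hΔle : Δ ≤ rG ystar + 1 := by linarith [(hr.range ybad).1]
  unfold upperBound
  rw [hgap, hP.apply_star hr]
  have hpos : 0 < (rG ystar + 1) ^ 2 / (ε ^ 2 * ((1 - p) * Δ)) * p⁻¹ := by positivity
  refine ⟨hpos, by gcongr, fun t ht => ?_⟩
  have key := h.le_softmaxPolicy_of_two_level hφ hlow (t := t) (η := ε / Δ)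
    (by rw [hP.apply_star hr]; linarith) (by positivity) (hpos.le.trans ht) ?_
  · exact key
  rw [hP.apply_star hr, ← hpdef, ← hΔdef]
  -- Two losses are absorbed: `Δ ≤ rG ystar + 1`, as rewards are at least `-1`, and `(1 - p) * Δ ≤
  -- Δ`.
  calc p⁻¹ = (ε / Δ) ^ 2 * Δ * (Δ ^ 2 / (ε ^ 2 * Δ) * p⁻¹) := by field_simp
    _ ≤ (ε / Δ) ^ 2 * Δ * ((rG ystar + 1) ^ 2 / (ε ^ 2 * ((1 - p) * Δ)) * p⁻¹) := by gcongr
    _ ≤ _ := by gcongr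

end HittingTimes

/-! ### Assembly of the two cases and the gap. -/

theorem mainTheorem1 (rstar rmed rbad ε : ℝ) :
    ∃ c C : ℝ, 0 < c ∧ 0 < C ∧ ∃ δ : ℝ → ℝ, (∀ T, 0 ≤ T → 0 < δ T) ∧
    ∀ (Y : Type*) [Fintype Y] (D : ℕ)
      (φ : Y → EuclideanSpace ℝ (Fin D)) (rG rP : Y → ℝ)
      (ystar ymed ybad : Y) (Ybad : Finset Y)
      (θ₀ : EuclideanSpace ℝ (Fin D)) (θG θP : ℝ → EuclideanSpace ℝ (Fin D))
      (Δ₁ Δ₂ pstar : ℝ) (tstar tnomed : EReal),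
      Orthonormal ℝ φ →
      RewardStructure rG ystar ymed Ybad →
      ybad ∈ Ybad →
      rG ystar = rstar → rG ymed = rmed → rG ybad = rbad →
      Δ₁ = rG ystar - rG ymed →
      Δ₂ = rG ymed - rG ybad →
      pstar = softmaxPolicy φ θ₀ ystar →
      InitialPolicyCondition (rG ymed) Δ₁ Δ₂ pstar (∑ y ∈ Ybad, softmaxPolicy φ θ₀ y) →
      IsNoMedProxy rG rP ymed Ybad →
      ε ∈ Set.Ioo 0 Δ₁ →
      IsGradientFlow (expectedReward φ rG) θ₀ θG →
      IsGradientFlow (expectedReward φ rP) θ₀ θP →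
      tstar = firstTime (fun t => expectedReward φ rG (θG t)) (rG ystar - ε) →
      tnomed = firstTime (fun t => expectedReward φ rG (θP t)) (rG ystar - ε) →
      -- Case I: maximizing the ground truth reward
      ((lowerBound (rG ymed) Δ₁ Δ₂ ε pstar : ℝ) : EReal) ≤ tstar ∧
      ((c * pstar ^ (-(14 / 13) : ℝ) : ℝ) : EReal) ≤ tstar ∧
      -- Case II: maximizing the proxy reward
      tnomed ≤ ((upperBound (rP ystar) (expectedReward φ rP θ₀) ε pstar : ℝ) : EReal) ∧
      tnomed ≤ ((C * pstar⁻¹ : ℝ) : EReal) ∧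
      (∀ t : ℝ, upperBound (rP ystar) (expectedReward φ rP θ₀) ε pstar ≤ t →
        1 - ε / (Δ₁ + Δ₂) ≤ softmaxPolicy φ (θP t) ystar) ∧
      -- The gap between the two times is arbitrarily large
      (∀ T : ℝ, 0 ≤ T → pstar < δ T → (T : EReal) ≤ tstar - tnomed) := by
  -- The constants are chosen before any policy is given; for reward values violating the
  -- assumptions the claim is vacuous and any positive constants serve.
  by_cases H : rbad ≤ 0 ∧ 0 < rmed ∧ rmed < rstar ∧ 0 < ε ∧ ε < rstar - rmed
  swap
  · refine ⟨1, 1, one_pos, one_pos, fun _ => 1, fun _ _ => one_pos, ?_⟩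
    intro Y _ D φ rG rP ystar ymed ybad Ybad θ₀ θG θP Δ₁ Δ₂ pstar tstar tnomed
      hφ hr hy hs hm hb hΔ₁ hΔ₂ hpdef hi hP hε hG hPf htstar htnomed
    refine absurd ⟨hb ▸ hr.bad_nonpos _ hy, hm ▸ hr.med_pos, ?_, hε.1, ?_⟩ H
    · rw [← hm, ← hs]
      exact hr.med_lt_star
    · rw [← hm, ← hs, ← hΔ₁]
      exact hε.2
  obtain ⟨H1, H2, H3, H4, H5⟩ := H
  have hA : 0 < rstar - rmed := sub_pos.2 H3
  have hE : 0 < rmed - rbad := by linarith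
  have hΔ : 0 < rstar - rbad := by linarith
  have hst : 0 < rstar + 1 := by linarith
  have hc := lowerBound_pos H2 hA hE H5 one_pos
  set c := lowerBound rmed (rstar - rmed) (rmed - rbad) ε 1 with hcdef
  set C := (rstar + 1) ^ 2 / (ε ^ 2 * ((rstar - rbad) / 2)) with hCdef
  have hC : 0 < C := by positivity
  -- `c` is the lower bound evaluated at `pstar = 1`. In `C`, the initial proxy gap is replaced by
  -- half of `rstar - rbad`, which is legitimate since `pstar ≤ 1/2`.
  refine ⟨c, C, hc, hC, fun T => min 1 ((c / (C + T)) ^ 13), fun T hT => by positivity, ?_⟩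
  intro Y _ D φ rG rP ystar ymed ybad Ybad θ₀ θG θP Δ₁ Δ₂ pstar tstar tnomed
    hφ hr hy hs hm hb hΔ₁ hΔ₂ hpdef hi hP hε hG hPf htstar htnomed
  subst hs hm hb hΔ₁ hΔ₂ hpdef htstar htnomed
  have hp := softmaxPolicy_pos φ θ₀ ystar
  have hrm1 := (hr.range ymed).2
  obtain ⟨-, -, -, -, -, -, hp1, -⟩ := hi.bounds H2 hrm1 hA hE
    (by linarith [(hr.range ybad).1]) hp
  obtain ⟨hU0, hUC, hU⟩ := hPf.upperBound_spec hφ hr hy hP H4 (by linarith)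
  have hlow := hG.lowerBound_le_firstTime hφ hr hy hi H5
  have hup := firstTime_le (v := fun t => expectedReward φ rG (θP t)) hU0.le
    (hr.sub_le_expectedReward hy (hU _ le_rfl))
  have hlow' := hlow
  rw [lowerBound_eq_mul_rpow, ← hcdef] at hlow'
  have hup' := hup.trans (EReal.coe_le_coe_iff.2 hUC)
  refine ⟨hlow, hlow', hup, hup', fun t ht => ?_, fun T hT hlt => ?_⟩
  · rw [sub_add_sub_cancel]
    exact hU t ht
  · refine le_trans ?_ (EReal.sub_le_sub hlow' hup')
    rw [← EReal.coe_sub]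
    exact EReal.coe_le_coe_iff.2 (le_mul_rpow_sub_mul_inv hc hC hT hp hlt)
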